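/- A metric space $X$ embeds isometrically in a metric space $Y$ if there is a map $f\colon X\to Y$ with $d_Y(f(x),f(y))=d_X(x,y)$ for all $x,y\in X$. Let $\mathfrak F_3$ be the class of all metric spaces with at most three points. A metric space $Y$ is called $\mathfrak F_3$-universal if every $X\in\mathfrak F_3$ embeds isometrically in $Y$; it is called minimal $\mathfrak F_3$-universal if, in addition, no proper subset of $Y$, with the induced metric, is $\mathfrak F_3$-universal. Theorem. Let $o,a,b$ be points of the Euclidean plane $\mathbb R^2$ with $a\neq o$ and $b\neq o$, let $\alpha=\angle aob\in[0,\pi]$ be the (smaller) angle between the rays $\overrightarrow{oa}$ and $\overrightarrow{ob}$, and let $$X_\alpha=\bigl(\overrightarrow{oa}\cup\overrightarrow{ob}\bigr)\setminus\{o\}$$ with the metric induced from $\mathbb R^2$. Then $X_\alpha$ is $\mathfrak F_3$-universal if and only if $0<\alpha<\frac{\pi}{3}$, and $X_\alpha$ is minimal $\mathfrak F_3$-universal if and only if $\frac{\pi}{5}\le\alpha<\frac{\pi}{3}$. -/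

import Mathlib

universe u v

/-- A class of metric spaces (with points in `Type u`), given by its membership predicate. -/
def MetricClass : Type (u + 1) := ∀ (X : Type u) [MetricSpace X], Prop

/-- `X ↪ Y`: there is a distance-preserving map from `X` to `Y`. -/
def EmbedsIsometrically (X : Type u) (Y : Type v) [MetricSpace X] [MetricSpace Y] : Prop :=
  ∃ f : X → Y, Isometry f

/-- `Y` is universal for the class `M`. -/
def IsUniversalFor (M : MetricClass.{u}) (Y : Type v) [MetricSpace Y] : Prop :=
  ∀ (X : Type u) [MetricSpace X], M X → EmbedsIsometrically X Y

/-- `Y` is minimal universal for `M`: it is universal for `M`, and a subspace of `Y` (with the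
induced metric) that is universal for `M` is all of `Y`. -/
def IsMinimalUniversalFor (M : MetricClass.{u}) (Y : Type v) [MetricSpace Y] : Prop :=
  IsUniversalFor M Y ∧ ∀ Y₀ : Set Y, IsUniversalFor M Y₀ → Y₀ = Set.univ

/-- The class of all metric spaces with at most three points (the empty space included). -/
def atMostThreePoints : MetricClass.{u} := fun X _ => ENat.card X ≤ 3

/-- The Euclidean plane. -/
abbrev Plane : Type := EuclideanSpace ℝ (Fin 2)

/-- The closed ray with origin `o` through `a` (for `a ≠ o`). -/
def closedRay (o a : Plane) : Set Plane := {x | ∃ t : ℝ, 0 ≤ t ∧ x = o + t • (a - o)}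

/-- The union of the rays `oa` and `ob`, with the point `o` removed. -/
def twoRays (o a b : Plane) : Set Plane := (closedRay o a ∪ closedRay o b) \ {o}

/-! Write `c = cos α`. If `P`, `Q` lie on one ray with `P` nearer to `o`, and `R` lies on the other,
then the angle of `PQR` at `P` is an exterior angle of `oPR`, hence exceeds `α`. Conversely, a
nondegenerate triangle with an angle `θ > α` can be placed with that vertex as `P`
(`exists_ray_coords`, `lt_of_ray_coords`). A largest angle is at least `π / 3`, so every triangle
fits when `0 < α < π / 3`; the equilateral triangle shows that this range is necessary.

For minimality, let `m = 2 sin (α / 2)`, so `m ^ 2 = 2 - 2 * c`. The points at distances `s` and `s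
+ s * m` on one ray and `s` on the other form an isosceles triangle with legs `s * m`, apex angle `π
/ 2 + α / 2` and base angles `(π - α) / 4`. The base angles exceed `α` exactly when `α < π / 5`,
that is, when `m ^ 2 + m - 1 < 0`. If `α ≥ π / 5`, the apex must play the role of `P`, which forces
the points at distance `s` on both rays into every universal subset (`eq_univ_of_isUniversalFor`).
If `α < π / 5`, a base vertex can serve as `P`, and a single point may be omitted
(`isUniversalFor_of_omit`). -/

/-- The open ray with origin `o` in the direction `u`. -/
def openRay (o u : Plane) : Set Plane := {x | ∃ t : ℝ, 0 < t ∧ x = o + t • u}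

/-- `Y` contains three points with mutual distances `x`, `y`, `z`. -/
def Realizes (Y : Type v) [MetricSpace Y] (x y z : ℝ) : Prop :=
  ∃ P Q R : Y, dist Q R = x ∧ dist P R = y ∧ dist P Q = z

lemma Realizes.swap_left {Y : Type v} [MetricSpace Y] {x y z : ℝ} (h : Realizes Y x y z) :
    Realizes Y y x z := by
  obtain ⟨P, Q, R, h1, h2, h3⟩ := h
  exact ⟨Q, P, R, h2, h1, by rw [dist_comm, h3]⟩

lemma Realizes.swap_right {Y : Type v} [MetricSpace Y] {x y z : ℝ} (h : Realizes Y x y z) :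
    Realizes Y x z y := by
  obtain ⟨P, Q, R, h1, h2, h3⟩ := h
  exact ⟨P, R, Q, by rw [dist_comm, h1], h3, h2⟩

/-! ### Universality in terms of triples of distances -/

lemma exists_cover_of_card_le_three (X : Type u) [Nonempty X] (h : ENat.card X ≤ 3) :
    ∃ A B C : X, ∀ x, x = A ∨ x = B ∨ x = C := by
  have hfin : Finite X := by
    rw [← ENat.card_lt_top]
    exact lt_of_le_of_lt h (by decide)
  have := Fintype.ofFinite X
  have hc : Fintype.card X ≤ 3 := by
    rw [ENat.card_eq_coe_fintype_card] at h
    exact_mod_cast h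
  have hle : Fintype.card X ≤ Fintype.card (Fin 3) := by simpa using hc
  obtain ⟨e⟩ := Function.Embedding.nonempty_of_card_le hle
  have hs : Function.Surjective (Function.invFun e) := Function.invFun_surjective e.injective
  refine ⟨Function.invFun e 0, Function.invFun e 1, Function.invFun e 2, fun x => ?_⟩
  obtain ⟨i, rfl⟩ := hs x
  fin_cases i <;> simp

lemma embedsIsometrically_of_cover {X : Type u} {Y : Type v} [MetricSpace X] [MetricSpace Y]
    {A B C : X} (hcov : ∀ x, x = A ∨ x = B ∨ x = C)
    (h : Realizes Y (dist B C) (dist A C) (dist A B)) : EmbedsIsometrically X Y := by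
  classical
  obtain ⟨P, Q, R, hx, hy, hz⟩ := h
  let f : X → Y := fun x => if x = A then P else if x = B then Q else R
  have fA : f A = P := by simp [f]
  have fB : f B = Q := by
    by_cases hBA : B = A
    · subst hBA
      rw [dist_self] at hz
      rw [fA, dist_eq_zero.1 hz]
    · simp [f, hBA]
  have fC : f C = R := by
    by_cases hCA : C = A
    · subst hCA
      rw [dist_self] at hy
      rw [fA, dist_eq_zero.1 hy]
    · by_cases hCB : C = B
      · subst hCB
        rw [dist_self] at hx
        rw [fB, dist_eq_zero.1 hx]
      · simp [f, hCA, hCB]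
  refine ⟨f, Isometry.of_dist_eq fun s t => ?_⟩
  rcases hcov s with rfl | rfl | rfl <;> rcases hcov t with rfl | rfl | rfl <;>
    simp only [fA, fB, fC, dist_self, hx, hy, hz] <;>
    first
      | (rw [dist_comm Q P, hz, dist_comm])
      | (rw [dist_comm R P, hy, dist_comm])
      | (rw [dist_comm R Q, hx, dist_comm])

lemma isUniversalFor_of_realizes {Y : Type v} [MetricSpace Y]
    (h : ∀ x y z : ℝ, 0 ≤ y → 0 ≤ z → y ≤ x → z ≤ x → x ≤ y + z → Realizes Y x y z) :
    IsUniversalFor atMostThreePoints.{u} Y := by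
  intro X _ hX
  rcases isEmpty_or_nonempty X with hE | hN
  · exact ⟨fun x => hE.elim x, fun x => hE.elim x⟩
  obtain ⟨A, B, C, hcov⟩ := exists_cover_of_card_le_three X hX
  apply embedsIsometrically_of_cover hcov
  have h0 : 0 ≤ dist A B := dist_nonneg
  have h1 : 0 ≤ dist A C := dist_nonneg
  have h2 : 0 ≤ dist B C := dist_nonneg
  have t1 : dist B C ≤ dist A C + dist A B := by
    have := dist_triangle B A C
    rw [dist_comm B A] at this
    linarith
  have t2 : dist A C ≤ dist B C + dist A B := by
    have := dist_triangle A B C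
    linarith
  have t3 : dist A B ≤ dist A C + dist B C := by
    have := dist_triangle A C B
    rwa [dist_comm C B] at this
  by_cases hab : dist A C ≤ dist B C
  · by_cases hac : dist A B ≤ dist B C
    · exact h _ _ _ h1 h0 hab hac t1
    · exact (h _ _ _ h1 h2 (by linarith) (by linarith) t3).swap_right.swap_left.swap_right
  · by_cases hac : dist A B ≤ dist A C
    · exact (h _ _ _ h2 h0 (by linarith) hac t2).swap_left
    · exact (h _ _ _ h1 h2 (by linarith) (by linarith) t3).swap_right.swap_left.swap_right

/-- Passing to the range of `![A, B, C]` allows coinciding points, and `ULift` moves it to the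
universe of the class. -/
lemma IsUniversalFor.realizes {Y : Type v} [MetricSpace Y]
    (h : IsUniversalFor atMostThreePoints.{u} Y) {Z : Type} [MetricSpace Z] (A B C : Z) :
    Realizes Y (dist B C) (dist A C) (dist A B) := by
  let F : Fin 3 → Z := ![A, B, C]
  have hcard : ENat.card (ULift.{u} (Set.range F)) ≤ 3 := by
    have h1 : Nat.card (ULift.{u} (Set.range F)) ≤ 3 := by
      rw [Nat.card_ulift]
      simpa using Finite.card_range_le F
    have := Fintype.ofFinite (ULift.{u} (Set.range F))
    rw [Nat.card_eq_fintype_card] at h1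
    rw [ENat.card_eq_coe_fintype_card]
    exact_mod_cast h1
  obtain ⟨f, hf⟩ := h (ULift.{u} (Set.range F)) hcard
  refine ⟨f ⟨⟨A, 0, rfl⟩⟩, f ⟨⟨B, 1, rfl⟩⟩, f ⟨⟨C, 2, rfl⟩⟩, ?_, ?_, ?_⟩ <;>
    rw [hf.dist_eq] <;> rfl

/-! ### Distances on two rays -/

lemma twoRays_eq_union {o a b : Plane} (ha : a ≠ o) (hb : b ≠ o) :
    ∃ u v : Plane, ‖u‖ = 1 ∧ ‖v‖ = 1 ∧ inner ℝ u v = Real.cos (EuclideanGeometry.angle a o b) ∧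
      twoRays o a b = openRay o u ∪ openRay o v := by
  have key : ∀ {a : Plane}, a ≠ o → ∀ x : Plane,
      (x ∈ closedRay o a ∧ x ≠ o) ↔ x ∈ openRay o (‖a - o‖⁻¹ • (a - o)) := by
    intro a ha x
    have hn : 0 < ‖a - o‖ := norm_pos_iff.2 (sub_ne_zero.2 ha)
    constructor
    · rintro ⟨⟨t, ht, rfl⟩, hx⟩
      have ht' : t ≠ 0 := by
        rintro rfl
        simp at hx
      refine ⟨t * ‖a - o‖, by positivity, ?_⟩
      rw [smul_smul, mul_assoc, mul_inv_cancel₀ hn.ne', mul_one]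
    · rintro ⟨t, ht, rfl⟩
      refine ⟨⟨t * ‖a - o‖⁻¹, by positivity, by rw [smul_smul]⟩, ?_⟩
      have : a - o ≠ 0 := sub_ne_zero.2 ha
      simp [ht.ne', this]
  have hna : ‖a - o‖ ≠ 0 := norm_ne_zero_iff.2 (sub_ne_zero.2 ha)
  have hnb : ‖b - o‖ ≠ 0 := norm_ne_zero_iff.2 (sub_ne_zero.2 hb)
  refine ⟨‖a - o‖⁻¹ • (a - o), ‖b - o‖⁻¹ • (b - o), ?_, ?_, ?_, ?_⟩
  · rw [norm_smul, norm_inv, norm_norm, inv_mul_cancel₀ hna]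
  · rw [norm_smul, norm_inv, norm_norm, inv_mul_cancel₀ hnb]
  · rw [EuclideanGeometry.angle, InnerProductGeometry.cos_angle, real_inner_smul_left,
      real_inner_smul_right, vsub_eq_sub, vsub_eq_sub]
    field_simp
  · ext x
    rw [Set.mem_union, ← key ha, ← key hb, twoRays]
    simp only [Set.mem_sdiff, Set.mem_union, Set.mem_singleton_iff]
    tauto

lemma dist_same_ray {o u : Plane} (hu : ‖u‖ = 1) (s t : ℝ) :
    dist (o + s • u) (o + t • u) = |s - t| := by
  rw [dist_add_left, dist_eq_norm, ← sub_smul, norm_smul, hu, mul_one, Real.norm_eq_abs]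

lemma dist_sq_rays {o u v : Plane} {c : ℝ} (hu : ‖u‖ = 1) (hv : ‖v‖ = 1) (hc : inner ℝ u v = c)
    (s t : ℝ) : dist (o + s • u) (o + t • v) ^ 2 = s ^ 2 + t ^ 2 - 2 * c * s * t := by
  rw [dist_add_left, dist_eq_norm, norm_sub_sq_real, norm_smul, norm_smul, hu, hv,
    real_inner_smul_left, real_inner_smul_right, hc]
  simp only [Real.norm_eq_abs, mul_one, sq_abs]
  ring

lemma dist_rays_eq {o u v : Plane} {c : ℝ} (hu : ‖u‖ = 1) (hv : ‖v‖ = 1) (hc : inner ℝ u v = c)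
    {s t d : ℝ} (hd : 0 ≤ d) (h : s ^ 2 + t ^ 2 - 2 * c * s * t = d ^ 2) :
    dist (o + s • u) (o + t • v) = d := by
  rw [← dist_sq_rays hu hv hc (o := o)] at h
  exact (pow_left_inj₀ dist_nonneg hd two_ne_zero).1 h

/-- The law of sines: a triangle whose angle at the first vertex has cosine less than `c` can be
placed with its first two vertices on one ray and the third on the other. -/
lemma exists_ray_coords {c x y z : ℝ} (hc0 : 0 < c) (hc1 : c < 1) (hy : 0 < y) (hz : 0 < z)
    (hx : 0 ≤ x) (hnd : x < y + z) (hk : y ^ 2 + z ^ 2 - x ^ 2 < 2 * c * y * z) :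
    ∃ p q : ℝ, 0 < p ∧ 0 < q ∧ p ^ 2 + q ^ 2 - 2 * c * p * q = y ^ 2 ∧
      (p + z) ^ 2 + q ^ 2 - 2 * c * (p + z) * q = x ^ 2 := by
  -- Here `k = cos θ`, with `θ` the angle at the first vertex; below, `S = sin α` and `T = sin θ`.
  -- The witnesses are `p = y sin (θ - α) / sin α` and `q = y sin θ / sin α`.
  obtain ⟨k, hkdef⟩ : ∃ k, k = (y ^ 2 + z ^ 2 - x ^ 2) / (2 * y * z) := ⟨_, rfl⟩
  have hyz : 0 < 2 * y * z := by positivity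
  have hk' : y ^ 2 + z ^ 2 - x ^ 2 = k * (2 * y * z) := by
    rw [hkdef]; field_simp
  have hkc : k < c := by
    rw [hkdef, div_lt_iff₀ hyz]; linarith
  have hk1 : -1 < k := by
    rw [hkdef, lt_div_iff₀ hyz]; nlinarith
  obtain ⟨S, hS, hS2⟩ : ∃ S : ℝ, 0 < S ∧ S ^ 2 = 1 - c ^ 2 :=
    ⟨√(1 - c ^ 2), Real.sqrt_pos.2 (by nlinarith), Real.sq_sqrt (by nlinarith)⟩
  obtain ⟨T, hT, hT2⟩ : ∃ T : ℝ, 0 < T ∧ T ^ 2 = 1 - k ^ 2 :=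
    ⟨√(1 - k ^ 2), Real.sqrt_pos.2 (by nlinarith), Real.sq_sqrt (by nlinarith)⟩
  have hpos : 0 < c * T - k * S := by
    rcases le_or_gt k 0 with h | h
    · have := mul_nonneg (neg_nonneg.2 h) hS.le
      have := mul_pos hc0 hT
      linarith
    · have : k * S < c * T := by
        apply lt_of_pow_lt_pow_left₀ 2 (by positivity)
        rw [mul_pow, mul_pow, hS2, hT2]
        nlinarith
      linarith
  have e1 : (y * (c * T - k * S) / S) ^ 2 + (y * T / S) ^ 2
      - 2 * c * (y * (c * T - k * S) / S) * (y * T / S) = y ^ 2 := by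
    field_simp
    linear_combination (1 - c ^ 2) * hT2 + (k ^ 2 - 1) * hS2
  refine ⟨y * (c * T - k * S) / S, y * T / S, by positivity, by positivity, e1, ?_⟩
  have e2 : y * (c * T - k * S) / S - c * (y * T / S) = - (k * y) := by
    field_simp
    ring
  linear_combination e1 + 2 * z * e2 + hk'

/-- Subtracting the equations gives `2 * p + z = 2 * c * q`: the third vertex projects to the
midpoint of the side on the ray. -/
lemma one_half_lt_of_equilateral {c p q z : ℝ} (hp : 0 < p) (hq : 0 < q) (hz : 0 < z)
    (h1 : p ^ 2 + q ^ 2 - 2 * c * p * q = z ^ 2)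
    (h2 : (p + z) ^ 2 + q ^ 2 - 2 * c * (p + z) * q = z ^ 2) : 1 / 2 < c ∧ c ≠ 1 := by
  have h3 : 2 * p + z = 2 * c * q := by
    apply mul_left_cancel₀ hz.ne'
    linear_combination h2 - h1
  constructor
  · by_contra! hc
    have h4 : 2 * p + z ≤ q := by nlinarith
    nlinarith [mul_pos hp hz, mul_pos hp hp]
  · rintro rfl
    nlinarith

/-- A triangle cannot have its first two vertices on one ray (the first one nearer to the origin)
and the third on the other, unless its angle at the first vertex has cosine less than `c`. -/
lemma lt_of_ray_coords {c p q x y z : ℝ} (hc0 : 0 < c) (hc1 : c < 1) (hp : 0 < p)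
    (hy : 0 < y) (hz : 0 < z) (h1 : p ^ 2 + q ^ 2 - 2 * c * p * q = y ^ 2)
    (h2 : (p + z) ^ 2 + q ^ 2 - 2 * c * (p + z) * q = x ^ 2) :
    y ^ 2 + z ^ 2 - x ^ 2 < 2 * c * y * z := by
  -- `c * q - p` is the signed projection onto the ray of the side of length `y`, i.e. `y cos θ`.
  have h3 : y ^ 2 + z ^ 2 - x ^ 2 = 2 * z * (c * q - p) := by linear_combination h2 - h1
  have h4 : c * q - p < c * y := by
    rcases le_or_gt (c * q - p) 0 with h | h
    · exact h.trans_lt (mul_pos hc0 hy)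
    · apply lt_of_pow_lt_pow_left₀ 2 (by positivity)
      rw [mul_pow, ← h1]
      have h5 : (c * q - p) ^ 2 < (c * q) ^ 2 := by
        apply pow_lt_pow_left₀ (by linarith) h.le two_ne_zero
      have h6 : 0 < 1 - c ^ 2 := by nlinarith
      nlinarith [mul_pos h6 (sub_pos.2 h5)]
  rw [h3]
  nlinarith

/-! ### The equilateral triangle -/

lemma exists_coords_of_mem {o u : Plane} {P Q : Plane} (hu : ‖u‖ = 1) (hP : P ∈ openRay o u)
    (hQ : Q ∈ openRay o u) : ∃ p q : ℝ, 0 < p ∧ 0 < q ∧ P = o + p • u ∧ Q = o + q • u ∧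
      (q = p + dist P Q ∨ p = q + dist P Q) := by
  obtain ⟨p, hp, rfl⟩ := hP
  obtain ⟨q, hq, rfl⟩ := hQ
  refine ⟨p, q, hp, hq, rfl, rfl, ?_⟩
  rw [dist_same_ray hu]
  rcases le_total p q with h | h
  · left; rw [abs_of_nonpos (by linarith)]; ring
  · right; rw [abs_of_nonneg (by linarith)]; ring

lemma one_half_lt_of_mem {o u v P Q R : Plane} {c d : ℝ} (hu : ‖u‖ = 1) (hv : ‖v‖ = 1)
    (hc : inner ℝ u v = c) (hd : 0 < d) (hP : P ∈ openRay o u) (hQ : Q ∈ openRay o u)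
    (hR : R ∈ openRay o v) (hx : dist Q R = d) (hy : dist P R = d) (hz : dist P Q = d) :
    1 / 2 < c ∧ c ≠ 1 := by
  obtain ⟨p, q, hp, hq, rfl, rfl, h⟩ := exists_coords_of_mem hu hP hQ
  obtain ⟨r, hr, rfl⟩ := hR
  rw [hz] at h
  have e1 := dist_sq_rays hu hv hc p r (o := o)
  have e2 := dist_sq_rays hu hv hc q r (o := o)
  rw [hy] at e1
  rw [hx] at e2
  rcases h with rfl | rfl
  · exact one_half_lt_of_equilateral hp hr hd e1.symm e2.symm
  · exact one_half_lt_of_equilateral hq hr hd e2.symm e1.symm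

lemma dist_add_of_mem_ray {o u P Q R : Plane} (hu : ‖u‖ = 1) (hP : P ∈ openRay o u)
    (hQ : Q ∈ openRay o u) (hR : R ∈ openRay o u) :
    dist Q R = dist P R + dist P Q ∨ dist P R = dist Q R + dist P Q ∨
      dist P Q = dist P R + dist Q R := by
  obtain ⟨p, -, rfl⟩ := hP
  obtain ⟨q, -, rfl⟩ := hQ
  obtain ⟨r, -, rfl⟩ := hR
  simp only [dist_same_ray hu]
  grind

lemma one_half_lt_of_isUniversalFor {o u v : Plane} {c : ℝ} {S : Set Plane} (hu : ‖u‖ = 1)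
    (hv : ‖v‖ = 1) (hc : inner ℝ u v = c) (hS : S = openRay o u ∪ openRay o v)
    (h : IsUniversalFor atMostThreePoints.{u} S) : 1 / 2 < c ∧ c ≠ 1 := by
  have hc' : inner ℝ v u = c := by rw [real_inner_comm, hc]
  obtain ⟨P, Q, R, hx, hy, hz⟩ := h.realizes (EuclideanSpace.single (0 : Fin 3) (1 : ℝ))
    (EuclideanSpace.single 1 1) (EuclideanSpace.single 2 1)
  have hd : ∀ i j : Fin 3, i ≠ j →
      dist (EuclideanSpace.single i (1 : ℝ)) (EuclideanSpace.single j 1) = √2 := by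
    intro i j hij
    rw [EuclideanSpace.dist_eq, Fin.sum_univ_three]
    congr 1
    fin_cases i <;> fin_cases j <;> simp [Real.dist_eq] at hij ⊢ <;> norm_num
  rw [hd _ _ (by decide), Subtype.dist_eq] at hx hy hz
  have hpos : 0 < √(2 : ℝ) := by positivity
  have hP : (P : Plane) ∈ openRay o u ∪ openRay o v := hS ▸ P.2
  have hQ : (Q : Plane) ∈ openRay o u ∪ openRay o v := hS ▸ Q.2
  have hR : (R : Plane) ∈ openRay o u ∪ openRay o v := hS ▸ R.2
  have hx' := hx
  have hy' := hy
  have hz' := hz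
  rw [dist_comm] at hx' hy' hz'
  rcases hP with hP | hP <;> rcases hQ with hQ | hQ <;> rcases hR with hR | hR
  · exfalso
    rcases dist_add_of_mem_ray hu hP hQ hR with h | h | h <;> rw [hx, hy, hz] at h <;> linarith
  · exact one_half_lt_of_mem hu hv hc hpos hP hQ hR hx hy hz
  · exact one_half_lt_of_mem hu hv hc hpos hP hR hQ hx' hz hy
  · exact one_half_lt_of_mem hv hu hc' hpos hQ hR hP hy' hz' hx
  · exact one_half_lt_of_mem hu hv hc hpos hQ hR hP hy' hz' hx
  · exact one_half_lt_of_mem hv hu hc' hpos hP hR hQ hx' hz hy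
  · exact one_half_lt_of_mem hv hu hc' hpos hP hQ hR hx hy hz
  · exfalso
    rcases dist_add_of_mem_ray hv hP hQ hR with h | h | h <;> rw [hx, hy, hz] at h <;> linarith

/-! ### Universality of small angles -/

lemma realizes_of_mem {S : Set Plane} {P Q R : Plane} (hP : P ∈ S) (hQ : Q ∈ S) (hR : R ∈ S)
    {x y z : ℝ} (hx : dist Q R = x) (hy : dist P R = y) (hz : dist P Q = z) : Realizes S x y z :=
  ⟨⟨P, hP⟩, ⟨Q, hQ⟩, ⟨R, hR⟩, hx, hy, hz⟩

lemma realizes_of_coords {o u v : Plane} {c p q x y z : ℝ} {S : Set Plane} (hu : ‖u‖ = 1)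
    (hv : ‖v‖ = 1) (hc : inner ℝ u v = c) (hx : 0 ≤ x) (hy : 0 ≤ y) (hz : 0 ≤ z)
    (hA : o + p • u ∈ S) (hB : o + (p + z) • u ∈ S) (hC : o + q • v ∈ S)
    (h1 : p ^ 2 + q ^ 2 - 2 * c * p * q = y ^ 2)
    (h2 : (p + z) ^ 2 + q ^ 2 - 2 * c * (p + z) * q = x ^ 2) : Realizes S x y z := by
  refine realizes_of_mem hA hB hC (dist_rays_eq hu hv hc hx h2) (dist_rays_eq hu hv hc hy h1) ?_
  rw [dist_same_ray hu, abs_of_nonpos (by linarith)]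
  ring

/-- Only parameters `t > 1` are required, so that the point at distance `1` may be missing. -/
lemma realizes_of_collinear {o u : Plane} {S : Set Plane} (hu : ‖u‖ = 1)
    (hS : ∀ t : ℝ, 1 < t → o + t • u ∈ S) {x y z : ℝ} (hy : 0 ≤ y) (hz : 0 ≤ z)
    (h : x = y + z) : Realizes S x y z := by
  refine realizes_of_mem (hS (2 + z) (by linarith)) (hS 2 (by norm_num))
    (hS (2 + z + y) (by linarith)) ?_ ?_ ?_ <;> rw [dist_same_ray hu]
  · rw [abs_of_nonpos (by linarith)]; linarith
  · rw [abs_of_nonpos (by linarith)]; linarith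
  · rw [abs_of_nonneg (by linarith)]; linarith

/-- The largest angle of a triangle is at least `π / 3`. -/
lemma cos_largest_lt {c x y z : ℝ} (hc : 1 / 2 < c) (hy : 0 < y) (hz : 0 < z) (hyx : y ≤ x)
    (hzx : z ≤ x) : y ^ 2 + z ^ 2 - x ^ 2 < 2 * c * y * z := by
  have h1 : 0 < (2 * c - 1) * (y * z) := by
    have := mul_pos hy hz
    apply mul_pos _ this
    linarith
  rcases le_total y z with h | h <;> nlinarith

lemma isUniversalFor_union {o u v : Plane} {c : ℝ} {S : Set Plane} (hu : ‖u‖ = 1)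
    (hv : ‖v‖ = 1) (hc : inner ℝ u v = c) (hS : S = openRay o u ∪ openRay o v) (hc2 : 1 / 2 < c)
    (hc1 : c < 1) : IsUniversalFor atMostThreePoints.{u} S := by
  subst hS
  apply isUniversalFor_of_realizes
  intro x y z hy hz hyx hzx hxyz
  have hmu : ∀ t : ℝ, 0 < t → o + t • u ∈ openRay o u ∪ openRay o v :=
    fun t ht => Or.inl ⟨t, ht, rfl⟩
  have hmv : ∀ t : ℝ, 0 < t → o + t • v ∈ openRay o u ∪ openRay o v :=
    fun t ht => Or.inr ⟨t, ht, rfl⟩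
  rcases hxyz.eq_or_lt with h | h
  · exact realizes_of_collinear hu (fun t ht => hmu t (by linarith)) hy hz h
  have hy' : 0 < y := by linarith
  have hz' : 0 < z := by linarith
  obtain ⟨p, q, hp, hq, h1, h2⟩ := exists_ray_coords (by linarith) hc1 hy' hz' (by linarith) h
    (cos_largest_lt hc2 hy' hz' hyx hzx)
  exact realizes_of_coords hu hv hc (by linarith) hy hz (hmu p hp) (hmu _ (by linarith))
    (hmv q hq) h1 h2

/-! ### A proper universal subset for angles less than `π / 5` -/

/-- A triangle realized in the two rays is realized without the point at distance `1` on the first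
ray, unless it has a special shape. -/
lemma realizes_or_special {o u v : Plane} {c x y z : ℝ} {S : Set Plane} (hu : ‖u‖ = 1)
    (hv : ‖v‖ = 1) (hc : inner ℝ u v = c) (hc0 : 0 < c) (hc1 : c < 1)
    (hSu : ∀ t : ℝ, 0 < t → t ≠ 1 → o + t • u ∈ S) (hSv : ∀ t : ℝ, 0 < t → o + t • v ∈ S)
    (hx : 0 ≤ x) (hy : 0 < y) (hz : 0 < z) (hnd : x < y + z)
    (hk : y ^ 2 + z ^ 2 - x ^ 2 < 2 * c * y * z) :
    Realizes S x y z ∨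
      (y ^ 2 = 2 - 2 * c ∧ x ^ 2 = (2 - 2 * c) + (2 - 2 * c) * z + z ^ 2) ∨
      (x ^ 2 = 2 - 2 * c ∧ y ^ 2 = (2 - 2 * c) - (2 - 2 * c) * z + z ^ 2) := by
  have hc' : inner ℝ v u = c := by rw [real_inner_comm, hc]
  obtain ⟨p, q, hp, hq, h1, h2⟩ := exists_ray_coords hc0 hc1 hy hz hx hnd hk
  by_cases hq1 : q = 1
  · subst hq1
    by_cases hp1 : p = 1
    · subst hp1
      right; left
      constructor
      · linear_combination - h1
      · linear_combination - h2
    by_cases hpz : p + z = 1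
    · right; right
      obtain rfl : p = 1 - z := by linarith
      constructor
      · linear_combination - h2
      · linear_combination - h1
    · left
      exact realizes_of_coords hu hv hc hx hy.le hz.le (hSu p hp hp1) (hSu _ (by linarith) hpz)
        (hSv 1 hq) h1 h2
  -- The lone vertex is not at distance `1`, so it can go on the punctured ray, with the other two
  -- on the full ray.
  · left
    exact realizes_of_coords hv hu hc' hx hy.le hz.le (hSv p hp) (hSv _ (by linarith))
      (hSu q hq hq1) h1 h2

lemma isUniversalFor_of_omit {o u v : Plane} {c : ℝ} {S : Set Plane} (hu : ‖u‖ = 1)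
    (hv : ‖v‖ = 1) (hc : inner ℝ u v = c) (hc2 : 1 / 2 < c) (hc1 : c < 1)
    (hc5 : ∀ t : ℝ, 0 ≤ t → t ^ 2 = 2 - 2 * c → t ^ 2 + t - 1 < 0)
    (hSu : ∀ t : ℝ, 0 < t → t ≠ 1 → o + t • u ∈ S) (hSv : ∀ t : ℝ, 0 < t → o + t • v ∈ S) :
    IsUniversalFor atMostThreePoints.{u} S := by
  apply isUniversalFor_of_realizes
  intro x y z hy hz hyx hzx hxyz
  rcases hxyz.eq_or_lt with h | h
  · exact realizes_of_collinear hu (fun t ht => hSu t (by linarith) ht.ne') hy hz h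
  have hy' : 0 < y := by linarith
  have hz' : 0 < z := by linarith
  have hx : 0 < x := by linarith
  have hc0 : 0 < c := by linarith
  have hm : 0 < 2 - 2 * c := by linarith
  rcases realizes_or_special hu hv hc hc0 hc1 hSu hSv hx.le hy' hz' h
    (cos_largest_lt hc2 hy' hz' hyx hzx) with hr | ⟨h1, h2⟩ | ⟨h1, h2⟩
  · exact hr
  -- The same largest angle gives a second placement with the roles of `y` and `z` exchanged; both
  -- must fail.
  all_goals
    rcases realizes_or_special hu hv hc hc0 hc1 hSu hSv hx.le hz' hy' (by linarith)
      (cos_largest_lt hc2 hz' hy' hzx hyx) with hr | ⟨h3, h4⟩ | ⟨h3, h4⟩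
  · exact hr.swap_right
  -- The one consistent exception is the isosceles triangle with legs `m`. Its base angle has cosine
  -- `x / (2 * y) < c`, so it is placed with a base vertex as `P`.
  · obtain rfl : y = z := (pow_left_inj₀ hy hz two_ne_zero).1 (h1.trans h3.symm)
    have h5 := hc5 y hy h1
    have h6 : y < 1 := by nlinarith
    have hx2 : x ^ 2 = y ^ 2 * (2 + y) := by rw [h2, ← h1]; ring
    have hcy : 2 * c = 2 - y ^ 2 := by linarith
    have h7 : x < y * (2 * c) := by
      apply lt_of_pow_lt_pow_left₀ 2 (by positivity)
      rw [hx2, mul_pow, hcy]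
      apply mul_lt_mul_of_pos_left _ (by positivity)
      have : 0 < (y + 1) * (2 - y) * (1 - y ^ 2 - y) :=
        mul_pos (mul_pos (by linarith) (by linarith)) (by linarith)
      nlinarith
    rcases realizes_or_special hu hv hc hc0 hc1 hSu hSv hy hx hy' (by linarith)
      (by nlinarith) with hr | ⟨h8, h9⟩ | ⟨h8, h9⟩
    · exact hr.swap_left
    · nlinarith [mul_pos hm hy']
    · nlinarith [mul_pos hm hy']
  · nlinarith [mul_pos hm hz']
  · exact hr.swap_right
  · nlinarith [mul_pos hm hy']
  -- This forces `y = z = 1`, but then `x ^ 2 = 2 - 2 * c < 1` contradicts `y ≤ x`.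
  · have h5 : y + z = 2 := by
      apply mul_left_cancel₀ hm.ne'
      linear_combination h2 + h4
    have h6 : (y - z) * (2 * (y + z) - (2 - 2 * c)) = 0 := by linear_combination h2 - h4
    rcases mul_eq_zero.1 h6 with h7 | h7
    · obtain rfl : y = z := by linarith
      obtain rfl : y = 1 := by linarith
      nlinarith
    · linarith

/-! ### Minimality for angles at least `π / 5` -/

/-- The isosceles triangle with legs `s * m` and base of square `(s * m) ^ 2 * (2 + m)`, where
`m ^ 2 = 2 - 2 * c`, has only one placement with a leg on one of the rays. -/
lemma coords_of_leg {c m s p q r : ℝ} (hc0 : 0 < c) (hc1 : c < 1) (hm : 0 < m)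
    (hm2 : m ^ 2 = 2 - 2 * c) (hs : 0 < s) (hm5 : 0 ≤ m ^ 2 + m - 1) (hp : 0 < p) (hq : 0 < q)
    (hr : 0 < r) (hpq : q = p + s * m ∨ p = q + s * m)
    (h1 : p ^ 2 + r ^ 2 - 2 * c * p * r = (s * m) ^ 2)
    (h2 : q ^ 2 + r ^ 2 - 2 * c * q * r = (s * m) ^ 2 * (2 + m)) : p = s ∧ r = s := by
  have hsm : 0 < s * m := mul_pos hs hm
  rcases hpq with rfl | rfl
  · have h3 : p - c * r = s * (1 - c) := by
      apply mul_left_cancel₀ (mul_pos two_pos hsm).ne'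
      linear_combination h2 - h1 + s ^ 2 * m * hm2
    have h4 : r ^ 2 = s ^ 2 := by
      have : (1 - c ^ 2) ≠ 0 := by nlinarith
      apply mul_left_cancel₀ this
      linear_combination h1 - (p - c * r + s * (1 - c)) * h3 + s ^ 2 * hm2
    obtain rfl : r = s := (pow_left_inj₀ hr.le hs.le two_ne_zero).1 h4
    exact ⟨by linarith, rfl⟩
  · exfalso
    have hx : (√((s * m) ^ 2 * (2 + m))) ^ 2 = (s * m) ^ 2 * (2 + m) :=
      Real.sq_sqrt (by positivity)
    have hxp : 0 < √((s * m) ^ 2 * (2 + m)) := Real.sqrt_pos.2 (by positivity)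
    set x := √((s * m) ^ 2 * (2 + m))
    -- Now a base vertex is nearest to `o`, so the base angle would have to exceed `α`; the
    -- factorization below rules this out.
    have h3 := lt_of_ray_coords hc0 hc1 hq hxp hsm (h2.trans hx.symm) h1
    have h4 : x < 2 * c * (s * m) := by nlinarith
    have h5 : x ^ 2 < (2 * c * (s * m)) ^ 2 := pow_lt_pow_left₀ h4 hxp.le two_ne_zero
    have h6 : 2 + m < (2 * c) ^ 2 := by
      refine lt_of_mul_lt_mul_right ?_ (sq_nonneg (s * m))
      linear_combination h5 - hx
    have hcm : 2 * c = 2 - m ^ 2 := by linarith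
    rw [hcm] at h6
    have : 0 ≤ (m + 1) * (2 - m) * (m ^ 2 + m - 1) :=
      mul_nonneg (mul_nonneg (by linarith) (by nlinarith)) hm5
    nlinarith

/-- The base of that triangle cannot lie on one of the rays. -/
lemma not_base_coords {c m s p q r : ℝ} (hc0 : 0 < c) (hc1 : c < 1) (hm : 0 < m)
    (hm2 : m ^ 2 = 2 - 2 * c) (hs : 0 < s) (hm5 : 0 ≤ m ^ 2 + m - 1) (hp : 0 < p)
    {x : ℝ} (hx : 0 < x) (hx2 : x ^ 2 = (s * m) ^ 2 * (2 + m)) (hpq : q = p + x)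
    (h1 : p ^ 2 + r ^ 2 - 2 * c * p * r = (s * m) ^ 2)
    (h2 : q ^ 2 + r ^ 2 - 2 * c * q * r = (s * m) ^ 2) : False := by
  subst hpq
  have hsm : 0 < s * m := mul_pos hs hm
  have h3 := lt_of_ray_coords hc0 hc1 hp hsm hx h1 h2
  have h4 : x < 2 * c * (s * m) := by nlinarith
  have h5 : x ^ 2 < (2 * c * (s * m)) ^ 2 := pow_lt_pow_left₀ h4 hx.le two_ne_zero
  have h6 : 2 + m < (2 * c) ^ 2 := by
    refine lt_of_mul_lt_mul_right ?_ (sq_nonneg (s * m))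
    linear_combination h5 - hx2
  have hcm : 2 * c = 2 - m ^ 2 := by linarith
  rw [hcm] at h6
  have : 0 ≤ (m + 1) * (2 - m) * (m ^ 2 + m - 1) :=
    mul_nonneg (mul_nonneg (by linarith) (by nlinarith)) hm5
  nlinarith

lemma eq_of_leg_mem {o u v P Q R : Plane} {c m s : ℝ} (hu : ‖u‖ = 1) (hv : ‖v‖ = 1)
    (hc : inner ℝ u v = c) (hc0 : 0 < c) (hc1 : c < 1) (hm : 0 < m)
    (hm2 : m ^ 2 = 2 - 2 * c) (hs : 0 < s) (hm5 : 0 ≤ m ^ 2 + m - 1) (hP : P ∈ openRay o u)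
    (hQ : Q ∈ openRay o u) (hR : R ∈ openRay o v) (hPQ : dist P Q = s * m)
    (hPR : dist P R = s * m) (hQR : dist Q R ^ 2 = (s * m) ^ 2 * (2 + m)) :
    P = o + s • u ∧ R = o + s • v := by
  obtain ⟨p, q, hp, hq, rfl, rfl, h⟩ := exists_coords_of_mem hu hP hQ
  obtain ⟨r, hr, rfl⟩ := hR
  have e1 := dist_sq_rays hu hv hc p r (o := o)
  rw [hPR] at e1
  rw [dist_sq_rays hu hv hc] at hQR
  rw [hPQ] at h
  obtain ⟨rfl, rfl⟩ := coords_of_leg hc0 hc1 hm hm2 hs hm5 hp hq hr h e1.symm hQR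
  exact ⟨rfl, rfl⟩

lemma not_base_mem {o u v P Q R : Plane} {c m s : ℝ} (hu : ‖u‖ = 1) (hv : ‖v‖ = 1)
    (hc : inner ℝ u v = c) (hc0 : 0 < c) (hc1 : c < 1) (hm : 0 < m)
    (hm2 : m ^ 2 = 2 - 2 * c) (hs : 0 < s) (hm5 : 0 ≤ m ^ 2 + m - 1) (hP : P ∈ openRay o v)
    (hQ : Q ∈ openRay o u) (hR : R ∈ openRay o u) (hPQ : dist P Q = s * m)
    (hPR : dist P R = s * m) (hQR : dist Q R ^ 2 = (s * m) ^ 2 * (2 + m)) : False := by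
  have hx : 0 < dist Q R := by
    refine lt_of_le_of_ne dist_nonneg fun h => ?_
    have : 0 < (s * m) ^ 2 * (2 + m) := by positivity
    rw [← hQR, ← h] at this
    norm_num at this
  obtain ⟨q, r, hq, hr, rfl, rfl, h⟩ := exists_coords_of_mem hu hQ hR
  obtain ⟨p, -, rfl⟩ := hP
  have e1 := dist_sq_rays hu hv hc q p (o := o)
  have e2 := dist_sq_rays hu hv hc r p (o := o)
  rw [dist_comm, hPQ] at e1
  rw [dist_comm, hPR] at e2
  rcases h with h | h
  · exact not_base_coords hc0 hc1 hm hm2 hs hm5 hq hx hQR h e1.symm e2.symm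
  · exact not_base_coords hc0 hc1 hm hm2 hs hm5 hr hx hQR h e2.symm e1.symm

lemma eq_univ_of_isUniversalFor {o u v : Plane} {c m : ℝ} {S : Set Plane} (hu : ‖u‖ = 1)
    (hv : ‖v‖ = 1) (hc : inner ℝ u v = c) (hS : S = openRay o u ∪ openRay o v) (hc0 : 0 < c)
    (hc1 : c < 1) (hm : 0 < m) (hm2 : m ^ 2 = 2 - 2 * c) (hm5 : 0 ≤ m ^ 2 + m - 1) {Y : Set S}
    (hY : IsUniversalFor atMostThreePoints.{u} Y) : Y = Set.univ := by
  have hc' : inner ℝ v u = c := by rw [real_inner_comm, hc]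
  have key : ∀ s : ℝ, 0 < s → (∃ y ∈ Y, (y : Plane) = o + s • u) ∧
      ∃ y ∈ Y, (y : Plane) = o + s • v := by
    intro s hs
    have hsm : 0 < s * m := mul_pos hs hm
    obtain ⟨P, Q, R, hx, hy, hz⟩ := hY.realizes (o + s • u) (o + (s + s * m) • u) (o + s • v)
    have hz' : dist (o + s • u) (o + (s + s * m) • u) = s * m := by
      rw [dist_same_ray hu, abs_of_nonpos (by linarith)]
      ring
    have hy' : dist (o + s • u) (o + s • v) = s * m :=
      dist_rays_eq hu hv hc hsm.le (by linear_combination - s ^ 2 * hm2)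
    have hx' := dist_sq_rays hu hv hc (s + s * m) s (o := o)
    rw [hz', Subtype.dist_eq, Subtype.dist_eq] at hz
    rw [hy', Subtype.dist_eq, Subtype.dist_eq] at hy
    rw [← hx, Subtype.dist_eq, Subtype.dist_eq] at hx'
    replace hx : dist (Q : Plane) (R : Plane) ^ 2 = (s * m) ^ 2 * (2 + m) := by
      rw [hx']
      linear_combination - (s ^ 2 * (1 + m)) * hm2
    have hxc : dist (R : Plane) (Q : Plane) ^ 2 = (s * m) ^ 2 * (2 + m) := by
      rw [dist_comm, hx]
    have hm22 : m < 2 := by nlinarith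
    have hcol : ¬ (dist (Q : Plane) (R : Plane) = dist (P : Plane) R + dist (P : Plane) Q ∨
        dist (P : Plane) R = dist (Q : Plane) R + dist (P : Plane) Q ∨
        dist (P : Plane) Q = dist (P : Plane) R + dist (Q : Plane) R) := by
      rw [hy, hz]
      have hpos : 0 < (s * m) ^ 2 := by positivity
      rintro (h | h | h)
      · rw [h] at hx
        nlinarith
      · have : dist (Q : Plane) (R : Plane) = 0 := by linarith
        rw [this] at hx
        nlinarith
      · have : dist (Q : Plane) (R : Plane) = 0 := by linarith
        rw [this] at hx
        nlinarith
    have hP : (P : Plane) ∈ openRay o u ∪ openRay o v := hS ▸ P.1.2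
    have hQ : (Q : Plane) ∈ openRay o u ∪ openRay o v := hS ▸ Q.1.2
    have hR : (R : Plane) ∈ openRay o u ∪ openRay o v := hS ▸ R.1.2
    rcases hP with hP | hP <;> rcases hQ with hQ | hQ <;> rcases hR with hR | hR
    · exact (hcol (dist_add_of_mem_ray hu hP hQ hR)).elim
    · obtain ⟨h1, h2⟩ := eq_of_leg_mem hu hv hc hc0 hc1 hm hm2 hs hm5 hP hQ hR hz hy hx
      exact ⟨⟨P, P.2, h1⟩, ⟨R, R.2, h2⟩⟩
    · obtain ⟨h1, h2⟩ := eq_of_leg_mem hu hv hc hc0 hc1 hm hm2 hs hm5 hP hR hQ hy hz hxc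
      exact ⟨⟨P, P.2, h1⟩, ⟨Q, Q.2, h2⟩⟩
    · exact (not_base_mem hv hu hc' hc0 hc1 hm hm2 hs hm5 hP hQ hR hz hy hx).elim
    · exact (not_base_mem hu hv hc hc0 hc1 hm hm2 hs hm5 hP hQ hR hz hy hx).elim
    · obtain ⟨h1, h2⟩ := eq_of_leg_mem hv hu hc' hc0 hc1 hm hm2 hs hm5 hP hR hQ hy hz hxc
      exact ⟨⟨Q, Q.2, h2⟩, ⟨P, P.2, h1⟩⟩
    · obtain ⟨h1, h2⟩ := eq_of_leg_mem hv hu hc' hc0 hc1 hm hm2 hs hm5 hP hQ hR hz hy hx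
      exact ⟨⟨R, R.2, h2⟩, ⟨P, P.2, h1⟩⟩
    · exact (hcol (dist_add_of_mem_ray hv hP hQ hR)).elim
  refine Set.eq_univ_of_forall fun x => ?_
  have hx : (x : Plane) ∈ openRay o u ∪ openRay o v := hS ▸ x.2
  rcases hx with ⟨s, hs, hxs⟩ | ⟨s, hs, hxs⟩
  · obtain ⟨y, hy, hys⟩ := (key s hs).1
    rwa [Subtype.ext (hxs.trans hys.symm)]
  · obtain ⟨y, hy, hys⟩ := (key s hs).2
    rwa [Subtype.ext (hxs.trans hys.symm)]

lemma exists_proper_universal {o u v : Plane} {c : ℝ} {S : Set Plane} (hu : ‖u‖ = 1)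
    (hv : ‖v‖ = 1) (hc : inner ℝ u v = c) (hS : S = openRay o u ∪ openRay o v)
    (hc2 : 1 / 2 < c) (hc1 : c < 1)
    (hc5 : ∀ t : ℝ, 0 ≤ t → t ^ 2 = 2 - 2 * c → t ^ 2 + t - 1 < 0) :
    ∃ Y : Set S, IsUniversalFor atMostThreePoints.{u} Y ∧ Y ≠ Set.univ := by
  have hmem : o + u ∈ S := by
    rw [hS]
    exact Or.inl ⟨1, one_pos, by rw [one_smul]⟩
  have huv : ∀ t : ℝ, 0 < t → o + t • v ≠ o + u := by
    intro t ht h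
    have e := dist_sq_rays hu hv hc 1 t (o := o)
    rw [one_smul, h, dist_self] at e
    nlinarith [sq_nonneg (1 - t)]
  have huu : ∀ t : ℝ, t ≠ 1 → o + t • u ≠ o + u := by
    intro t ht h
    have e := dist_same_ray hu t 1 (o := o)
    rw [one_smul, h, dist_self] at e
    exact ht (sub_eq_zero.1 (abs_eq_zero.1 e.symm))
  have huniv : IsUniversalFor atMostThreePoints.{u} {x : Plane | x ∈ S ∧ x ≠ o + u} := by
    apply isUniversalFor_of_omit hu hv hc hc2 hc1 hc5
    · intro t ht ht1
      refine ⟨?_, huu t ht1⟩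
      rw [hS]
      exact Or.inl ⟨t, ht, rfl⟩
    · intro t ht
      refine ⟨?_, huv t ht⟩
      rw [hS]
      exact Or.inr ⟨t, ht, rfl⟩
  refine ⟨{x : S | (x : Plane) ≠ o + u}, ?_, ?_⟩
  · intro X _ hX
    obtain ⟨f, hf⟩ := huniv X hX
    exact ⟨fun x => ⟨⟨f x, (f x).2.1⟩, (f x).2.2⟩, fun x y => hf x y⟩
  · intro h
    have : (⟨o + u, hmem⟩ : S) ∈ {x : S | (x : Plane) ≠ o + u} := h ▸ Set.mem_univ _
    exact this rfl

/-! ### Cosines -/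

/-- With `c = cos α` and `t = 2 sin (α / 2)`, the positive root `(√5 - 1) / 2` corresponds to `c =
cos (π / 5)`. -/
lemma sq_add_sub_one_nonneg_iff {c t : ℝ} (ht : 0 ≤ t) (ht2 : t ^ 2 = 2 - 2 * c) :
    0 ≤ t ^ 2 + t - 1 ↔ c ≤ (1 + √5) / 4 := by
  have h5 : √5 ^ 2 = (5 : ℝ) := Real.sq_sqrt (by norm_num)
  have h1 : (1 : ℝ) < √5 := by
    rw [Real.lt_sqrt] <;> norm_num
  have e : t ^ 2 + t - 1 = (t - (√5 - 1) / 2) * (t + (√5 + 1) / 2) := by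
    linear_combination (1 / 4) * h5
  have e' : (1 + √5) / 4 - c = (1 / 2) * ((t - (√5 - 1) / 2) * (t + (√5 - 1) / 2)) := by
    linear_combination (1 / 8) * h5 - (1 / 2) * ht2
  rw [← sub_nonneg (b := c), e, e', mul_nonneg_iff_of_pos_right (by linarith),
    mul_nonneg_iff_of_pos_left (by norm_num), mul_nonneg_iff_of_pos_right (by linarith)]

theorem theoremt7p3 (o a b : Plane) (ha : a ≠ o) (hb : b ≠ o) (α : ℝ)
    (hα : α = EuclideanGeometry.angle a o b) :
    (IsUniversalFor atMostThreePoints.{u} (twoRays o a b) ↔ 0 < α ∧ α < Real.pi / 3) ∧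
    (IsMinimalUniversalFor atMostThreePoints.{u} (twoRays o a b) ↔
      Real.pi / 5 ≤ α ∧ α < Real.pi / 3) := by
  obtain ⟨u, v, hu, hv, hc, hS⟩ := twoRays_eq_union ha hb
  rw [← hα] at hc
  have hpi := Real.pi_pos
  have hα0 : 0 ≤ α := hα ▸ EuclideanGeometry.angle_nonneg _ _ _
  have hαπ : α ≤ Real.pi := hα ▸ EuclideanGeometry.angle_le_pi _ _ _
  have mem : ∀ {x : ℝ}, 0 ≤ x → x ≤ Real.pi → x ∈ Set.Icc 0 Real.pi := fun h h' => ⟨h, h'⟩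
  have hlt3 : α < Real.pi / 3 ↔ 1 / 2 < Real.cos α := by
    rw [← Real.cos_pi_div_three]
    exact (Real.strictAntiOn_cos.lt_iff_gt (mem (by linarith) (by linarith))
      (mem hα0 hαπ)).symm
  have hle5 : Real.pi / 5 ≤ α ↔ Real.cos α ≤ (1 + √5) / 4 := by
    rw [← Real.cos_pi_div_five]
    exact (Real.strictAntiOn_cos.le_iff_ge (mem hα0 hαπ)
      (mem (by linarith) (by linarith))).symm
  have hpos : 0 < α ↔ Real.cos α < 1 := by
    rw [← Real.cos_zero]
    exact (Real.strictAntiOn_cos.lt_iff_gt (mem hα0 hαπ) (mem le_rfl hpi.le)).symm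
  have huniv : IsUniversalFor atMostThreePoints.{u} (twoRays o a b) ↔
      0 < α ∧ α < Real.pi / 3 := by
    rw [hpos, hlt3]
    constructor
    · intro h
      obtain ⟨h1, h2⟩ := one_half_lt_of_isUniversalFor hu hv hc hS h
      exact ⟨lt_of_le_of_ne (Real.cos_le_one α) h2, h1⟩
    · rintro ⟨h1, h2⟩
      exact isUniversalFor_union hu hv hc hS h2 h1
  refine ⟨huniv, ?_⟩
  constructor
  · rintro ⟨h, hmin⟩
    obtain ⟨h0, h3⟩ := huniv.1 h
    refine ⟨?_, h3⟩
    by_contra hlt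
    rw [hle5] at hlt
    obtain ⟨Y, hY, hne⟩ := exists_proper_universal hu hv hc hS (hlt3.1 h3) (hpos.1 h0)
      (fun t ht ht2 => by
        rw [← not_le, sq_add_sub_one_nonneg_iff ht ht2]
        exact hlt)
    exact hne (hmin Y hY)
  · rintro ⟨h5, h3⟩
    have h0 : 0 < α := by linarith
    refine ⟨huniv.2 ⟨h0, h3⟩, fun Y hY => ?_⟩
    have hc1 := hpos.1 h0
    have hm2 : √(2 - 2 * Real.cos α) ^ 2 = 2 - 2 * Real.cos α := Real.sq_sqrt (by linarith)
    exact eq_univ_of_isUniversalFor hu hv hc hS (by linarith [hlt3.1 h3]) hc1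
      (Real.sqrt_pos.2 (by linarith)) hm2
      ((sq_add_sub_one_nonneg_iff (Real.sqrt_nonneg _) hm2).2 (hle5.1 h5)) hY
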